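/- Let $p$ be a prime with $p\equiv 1 \pmod 4$, let $\pi\in\mathbb Z[i]$ with $N(\pi)=\pi\overline\pi=p$, and let $G_\pi=\mathbb Z[i]/(\pi)$, a field with $p$ elements. Each class $\gamma\in G_\pi$ has a reduced representative $\zeta-[\zeta\overline\pi/p]\,\pi$ ($\zeta\in\gamma$ arbitrary, $[\cdot]$ rounding real and imaginary parts to the closest integer); write $w_M(\gamma)=|\mathrm{Re}|+|\mathrm{Im}|$ of this representative. For $(u|v)\in G_\pi^{2n}$ put $wt_M(u|v)=\left\lceil \tfrac12\sum_{j}\bigl(w_M(u_j)+w_M(v_j)\bigr)\right\rceil$ and $(u|v)*(u'|v')=v\cdot u'-v'\cdot u$; for a linear code $C\subseteq G_\pi^{2n}$ let $C^{\perp_*}$ be its dual for $*$. Let $\xi$ be a primitive $p$-th root of unity and let $(\mathbb C^p)^{\otimes n}$ have the orthonormal basis $|u\rangle$, $u\in G_\pi^n$. For $a,b\in G_\pi^n$ let $X_a|u\rangle=|a+u\rangle$ and $Z_b|u\rangle=\xi^{\mu^{-1}(b\cdot u)}|u\rangle$, where $\mu^{-1}:G_\pi\to\mathbb F_p$ is the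 canonical isomorphism. A quantum code is a subspace $Q\subseteq(\mathbb C^p)^{\otimes n}$; with $P$ the orthogonal projection onto $Q$, it detects an operator $E$ if $PEP$ is a scalar multiple of $P$; its minimum (Mannheim) distance is the least $wt_M(a|b)$ of an error $X_aZ_b$ that it does not detect. Let $C_1,C_2\subseteq G_\pi^n$ be linear codes, $C_1^\perp$ the dual of $C_1$ for the usual inner product $u\cdot v=\sum_j u_jv_j$, and let $C=(C_2|C_1^\perp)=\{(u|v):u\in C_2,\ v\in C_1^\perp\}\subseteq G_\pi^{2n}$ satisfy $C\subseteq C^{\perp_*}$. Then $K=\dim C^{\perp_*}-\dim C$ is even, and there is a quantum code $Q\subseteq(\mathbb C^p)^{\otimes n}$ of dimension $p^{K/2}$, i.e. an $[[n,K/2,d_M]]_\pi$ code, whose minimum distance, if $C\ne C^{\perp_*}$, is $$d_M=\min\{wt_M(w):\ w\in C^{\perp_*}\setminus C\}.$$ Moreover, $Q$ contains a $K$-dimensional subspace which, if $C\ne C^{\perp_*}$, has the same minimum distance $d_M$. -/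

import Mathlib

namespace MannheimQuantum

/-- The residue class ring `G_π = ℤ[i] / (π)` of the Gaussian integers. -/
abbrev Gres (π : GaussianInt) : Type := GaussianInt ⧸ Ideal.span {π}

/-- The reduction `ζ mod π = ζ - [ζ π̄ / (π π̄)] π`, where `[·]` rounds the real and the imaginary
part to the closest integer (see `reduce_eq`). -/
def reduce (π ζ : GaussianInt) : GaussianInt := ζ % π

theorem reduce_eq (π ζ : GaussianInt) :
    reduce π ζ = ζ - (⟨round ((ζ * star π).re / (Zsqrtd.norm π : ℚ)),
      round ((ζ * star π).im / (Zsqrtd.norm π : ℚ))⟩ : GaussianInt) * π := by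
  rw [reduce, GaussianInt.mod_def, GaussianInt.div_def, mul_comm]

theorem mk_reduce (π ζ : GaussianInt) :
    Ideal.Quotient.mk (Ideal.span {π}) (reduce π ζ) = Ideal.Quotient.mk (Ideal.span {π}) ζ := by
  rw [Ideal.Quotient.eq, Ideal.mem_span_singleton, reduce, GaussianInt.mod_def]
  exact ⟨-(ζ / π), by ring⟩

/-- The reduction depends on the residue class only. -/
theorem reduce_congr {π : GaussianInt} (hπ : π ≠ 0) {ζ ζ' : GaussianInt}
    (h : Ideal.Quotient.mk (Ideal.span {π}) ζ = Ideal.Quotient.mk (Ideal.span {π}) ζ') :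
    reduce π ζ = reduce π ζ' := by
  rw [Ideal.Quotient.eq, Ideal.mem_span_singleton] at h
  obtain ⟨k, hk⟩ := h
  obtain rfl : ζ = ζ' + π * k := by rw [← hk]; ring
  have hN : (Zsqrtd.norm π : ℚ) ≠ 0 := by
    exact_mod_cast fun h => hπ (GaussianInt.norm_eq_zero.1 h)
  have hmul : (ζ' + π * k) * star π = ζ' * star π + k * (Zsqrtd.norm π : GaussianInt) := by
    rw [Zsqrtd.norm_eq_mul_conj]; ring
  rw [reduce_eq, reduce_eq, hmul]
  have h1 : ((ζ' * star π + k * (Zsqrtd.norm π : GaussianInt)).re : ℚ) / (Zsqrtd.norm π : ℚ)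
      = (ζ' * star π).re / (Zsqrtd.norm π : ℚ) + (k.re : ℤ) := by
    field_simp; simp [mul_comm]
  have h2 : ((ζ' * star π + k * (Zsqrtd.norm π : GaussianInt)).im : ℚ) / (Zsqrtd.norm π : ℚ)
      = (ζ' * star π).im / (Zsqrtd.norm π : ℚ) + (k.im : ℤ) := by
    field_simp; simp [mul_comm]
  rw [h1, h2, round_add_intCast, round_add_intCast]
  ext <;> simp <;> ring

/-- The Mannheim weight `|Re γ| + |Im γ|` of a residue class, where `γ` is its reduced
representative (see `mannheimWeight_mk`). -/
noncomputable def mannheimWeight {π : GaussianInt} (x : Gres π) : ℕ :=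
  (reduce π (Quotient.out x)).re.natAbs + (reduce π (Quotient.out x)).im.natAbs

theorem mannheimWeight_mk {π : GaussianInt} (hπ : π ≠ 0) (ζ : GaussianInt) :
    mannheimWeight (Ideal.Quotient.mk (Ideal.span {π}) ζ) =
      (reduce π ζ).re.natAbs + (reduce π ζ).im.natAbs := by
  have h : reduce π (Quotient.out (Ideal.Quotient.mk (Ideal.span {π}) ζ)) = reduce π ζ :=
    reduce_congr hπ (Quotient.out_eq _)
  rw [mannheimWeight, h]

instance instFiniteGres (π : GaussianInt) [NeZero π] : Finite (Gres π) := by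
  have hπ : π ≠ 0 := NeZero.ne π
  let N : ℤ := Zsqrtd.norm π
  let f : (Set.Icc (-N) N) × (Set.Icc (-N) N) → Gres π :=
    fun q => Ideal.Quotient.mk _ (⟨q.1, q.2⟩ : GaussianInt)
  refine Finite.of_surjective f fun x => ?_
  obtain ⟨ζ, rfl⟩ := Ideal.Quotient.mk_surjective x
  have h := GaussianInt.norm_mod_lt ζ hπ
  rw [Zsqrtd.norm_def] at h
  have hr : (ζ % π).re ∈ Set.Icc (-N) N := by
    constructor <;> nlinarith [sq_nonneg (ζ % π).im, sq_nonneg ((ζ % π).re - 1),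
      sq_nonneg ((ζ % π).re + 1), h]
  have hi : (ζ % π).im ∈ Set.Icc (-N) N := by
    constructor <;> nlinarith [sq_nonneg (ζ % π).re, sq_nonneg ((ζ % π).im - 1),
      sq_nonneg ((ζ % π).im + 1), h]
  exact ⟨(⟨_, hr⟩, ⟨_, hi⟩), mk_reduce π ζ⟩

noncomputable instance instFintypeGres (π : GaussianInt) [NeZero π] : Fintype (Gres π) :=
  Fintype.ofFinite _

/-- The space `G_π^{2n}` of pairs `(u | v)`. -/
abbrev Pairs (π : GaussianInt) (n : ℕ) : Type := (Fin n → Gres π) × (Fin n → Gres π)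

/-- The symplectic form `(u | v) * (u' | v') = v · u' - v' · u`. -/
def sympl {π : GaussianInt} {n : ℕ} (w w' : Pairs π n) : Gres π :=
  w.2 ⬝ᵥ w'.1 - w'.2 ⬝ᵥ w.1

/-- The dual `C^⊥` of a linear code for the usual inner product. -/
def dualCode {π : GaussianInt} {n : ℕ} (C : Submodule (Gres π) (Fin n → Gres π)) :
    Submodule (Gres π) (Fin n → Gres π) where
  carrier := {v | ∀ u ∈ C, v ⬝ᵥ u = 0}
  zero_mem' := by intro u _; simp
  add_mem' := by
    intro v v' hv hv' u hu
    rw [add_dotProduct, hv u hu, hv' u hu, add_zero]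
  smul_mem' := by
    intro c v hv u hu
    rw [smul_dotProduct, hv u hu, smul_zero]

/-- The dual `C^{⊥*}` of a linear code in `G_π^{2n}` for the symplectic form. -/
def symplDual {π : GaussianInt} {n : ℕ} (C : Submodule (Gres π) (Pairs π n)) :
    Submodule (Gres π) (Pairs π n) where
  carrier := {w | ∀ w' ∈ C, sympl w w' = 0}
  zero_mem' := by intro w' _; simp [sympl]
  add_mem' := by
    intro w z hw hz w' hw'
    have h1 := hw w' hw'
    have h2 := hz w' hw'
    simp only [sympl, Prod.fst_add, Prod.snd_add, add_dotProduct, dotProduct_add] at h1 h2 ⊢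
    linear_combination h1 + h2
  smul_mem' := by
    intro c w hw w' hw'
    have h1 := hw w' hw'
    simp only [sympl, Prod.smul_fst, Prod.smul_snd, smul_dotProduct, dotProduct_smul,
      smul_eq_mul] at h1 ⊢
    linear_combination c * h1

/-- The Mannheim weight `wt_M` on `G_π^{2n}`: half the sum of the Mannheim weights of all
coordinates, rounded up. -/
noncomputable def wtM {π : GaussianInt} {n : ℕ} (w : Pairs π n) : ℕ :=
  ⌈((∑ i, (mannheimWeight (w.1 i) : ℚ)) + ∑ i, (mannheimWeight (w.2 i) : ℚ)) / 2⌉₊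

/-- The Hilbert space `(ℂ^p)^{⊗ n}`, with orthonormal basis `|u⟩`, `u ∈ G_π^n`. -/
abbrev HSpace (π : GaussianInt) [NeZero π] (n : ℕ) : Type :=
  EuclideanSpace ℂ (Fin n → Gres π)

/-- The inverse of `μ : F_p → G_π`: the least natural number in the class `x`
(it exists if `π π̄` is a prime, see `natCast_muInv`, and is then smaller than that prime). -/
noncomputable def muInv {π : GaussianInt} (x : Gres π) : ℕ := sInf {g : ℕ | (g : Gres π) = x}

theorem natCast_muInv {π : GaussianInt} {p : ℕ} (hp : p.Prime) (hπ : Zsqrtd.norm π = p)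
    (x : Gres π) : ((muInv x : ℕ) : Gres π) = x := by
  suffices h : {g : ℕ | (g : Gres π) = x}.Nonempty from Nat.sInf_mem h
  obtain ⟨a, ha⟩ : ∃ a, a = π.re := ⟨_, rfl⟩
  obtain ⟨b, hb0⟩ : ∃ b, b = π.im := ⟨_, rfl⟩
  have hab : a * a + b * b = p := by
    rw [Zsqrtd.norm_def] at hπ; subst ha hb0; linear_combination hπ
  have hpr : Prime (p : ℤ) := Nat.prime_iff_prime_int.1 hp
  have hb : ¬ (p : ℤ) ∣ b := by
    rintro ⟨k, hk⟩
    have h2 : (p : ℤ) ∣ a := by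
      have : (p : ℤ) ∣ a * a := ⟨1 - k * (p * k), by rw [hk] at hab; linear_combination hab⟩
      exact (hpr.dvd_or_dvd this).elim id id
    obtain ⟨l, hl⟩ := h2
    have h3 : (p : ℤ) * (l * l * p + k * k * p) = p * 1 := by
      rw [hk, hl] at hab; linear_combination hab
    have h4 := mul_left_cancel₀ hpr.ne_zero h3
    exact hpr.not_isUnit (IsUnit.of_mul_eq_one (l * l + k * k) (by linear_combination h4))
  obtain ⟨c, d, hcd⟩ := (hpr.coprime_iff_not_dvd.2 hb)
  let q : GaussianInt →+* Gres π := Ideal.Quotient.mk (Ideal.span {π})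
  have hqπ : q π = 0 := Ideal.Quotient.eq_zero_iff_mem.2 (Ideal.mem_span_singleton_self π)
  have hqp : (p : Gres π) = 0 := by
    have h5 : ((p : ℤ) : GaussianInt) = π * star π := by
      rw [← hπ, Zsqrtd.norm_eq_mul_conj]
    have h6 : q ((p : ℤ) : GaussianInt) = 0 := by rw [h5, map_mul, hqπ, zero_mul]
    simpa using h6
  let I : GaussianInt := ⟨0, 1⟩
  have hdec : ∀ z : GaussianInt, q z = (z.re : Gres π) + (z.im : Gres π) * q I := by
    intro z
    have hz : z = (z.re : GaussianInt) + (z.im : GaussianInt) * I := by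
      ext <;> simp [I]
    conv_lhs => rw [hz]
    simp
  have hI : q I = ((-(d * a) : ℤ) : Gres π) := by
    have h7 := hdec π
    rw [hqπ] at h7
    have h8 : (c : Gres π) * (p : Gres π) + (d : Gres π) * (b : Gres π) = 1 := by
      have := congrArg (Int.cast : ℤ → Gres π) hcd
      simpa using this
    push_cast
    rw [← ha, ← hb0] at h7
    linear_combination (-(q I)) * h8 + (c : Gres π) * q I * hqp - (d : Gres π) * h7
  obtain ⟨z, rfl⟩ := Ideal.Quotient.mk_surjective x
  let m : ℤ := z.re + z.im * (-(d * a))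
  have hm : (m : Gres π) = q z := by rw [hdec z, hI]; simp [m]
  refine ⟨(m % p).toNat, ?_⟩
  have hp0 : (p : ℤ) ≠ 0 := hpr.ne_zero
  have h9 : (((m % p).toNat : ℤ) : Gres π) = (m : Gres π) := by
    rw [Int.toNat_of_nonneg (Int.emod_nonneg _ hp0)]
    conv_rhs => rw [← Int.emod_add_mul_ediv m p]
    simp [hqp]
  change (((m % p).toNat : ℕ) : Gres π) = q z
  rw [← hm, ← h9]
  exact (Int.cast_natCast _).symm

/-- The tensor product `X_a` of the shifts `|u_i⟩ ↦ |a_i + u_i⟩` (see `shiftOp_ket`). -/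
noncomputable def shiftOp {π : GaussianInt} [NeZero π] {n : ℕ} (a : Fin n → Gres π) :
    HSpace π n →ₗ[ℂ] HSpace π n where
  toFun ψ := WithLp.toLp 2 fun u => ψ (u - a)
  map_add' ψ φ := by ext u; simp
  map_smul' c ψ := by ext u; simp

/-- The tensor product `Z_b` of the phase operators `|u_i⟩ ↦ ξ ^ μ⁻¹(b_i u_i) |u_i⟩`
(see `phaseOp_ket`). -/
noncomputable def phaseOp {π : GaussianInt} [NeZero π] {n : ℕ} (ξ : ℂ) (b : Fin n → Gres π) :
    HSpace π n →ₗ[ℂ] HSpace π n where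
  toFun ψ := WithLp.toLp 2 fun u => (∏ i, ξ ^ muInv (b i * u i)) * ψ u
  map_add' ψ φ := by ext u; simp [mul_add]
  map_smul' c ψ := by ext u; simp; ring

open Classical in
theorem shiftOp_ket {π : GaussianInt} [NeZero π] {n : ℕ} (a u : Fin n → Gres π) :
    shiftOp a (EuclideanSpace.single u (1 : ℂ)) = EuclideanSpace.single (a + u) 1 := by
  ext v
  simp [shiftOp, sub_eq_iff_eq_add, add_comm]

open Classical in
theorem phaseOp_ket {π : GaussianInt} [NeZero π] {n : ℕ} (ξ : ℂ) (b u : Fin n → Gres π) :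
    phaseOp ξ b (EuclideanSpace.single u (1 : ℂ)) =
      (∏ i, ξ ^ muInv (b i * u i)) • EuclideanSpace.single u 1 := by
  ext v
  by_cases h : v = u
  · subst h; simp [phaseOp]
  · simp [phaseOp, h]

/-- The error operator `X_a Z_b` with label `(a | b)`. -/
noncomputable def errorOp {π : GaussianInt} [NeZero π] {n : ℕ} (ξ : ℂ) (w : Pairs π n) :
    HSpace π n →ₗ[ℂ] HSpace π n :=
  shiftOp w.1 ∘ₗ phaseOp ξ w.2

/-- The quantum code `Q` detects the error `E`: `P E P = c P` for a scalar `c`, where `P` is the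
orthogonal projection onto `Q`. -/
def Detects {π : GaussianInt} [NeZero π] {n : ℕ} (Q : Submodule ℂ (HSpace π n))
    (E : HSpace π n →ₗ[ℂ] HSpace π n) : Prop :=
  ∃ c : ℂ, ∀ x ∈ Q, ∀ y ∈ Q, inner ℂ x (E y) = c * inner ℂ x y

/-- `d` is the minimum distance of the quantum code `Q` for the Mannheim weight: all errors
`X_a Z_b` with `wt_M (a | b) < d` are detected, and some error with `wt_M (a | b) = d` is not. -/
def HasMinDist {π : GaussianInt} [NeZero π] {n : ℕ} (ξ : ℂ) (Q : Submodule ℂ (HSpace π n))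
    (d : ℕ) : Prop :=
  IsLeast {m : ℕ | ∃ w : Pairs π n, ¬ Detects Q (errorOp ξ w) ∧ wtM w = m} d

end MannheimQuantum

namespace MannheimQuantum

/-! ### The field `G_π` and its additive character. -/

section Residue

variable {π : GaussianInt} {p : ℕ}

/-! This is the CSS construction. Since `C₁^⊥⊥ = C₁`, the symplectic dual of `C₂ × C₁^⊥` is `C₁ ×
C₂^⊥`. Self-orthogonality thus gives `C₂ ≤ C₁`, and the dimension gap is `2k` with `k = dim C₁/C₂`.
`Q` is spanned by the `p ^ k` orthogonal coset states `∑ |u⟩`, `u ∈ x + C₂`, with `x ∈ C₁`.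

An error `X_a Z_b` weights a coset by the character `ξ ^ μ⁻¹(b · u)` and translates it by `a`
(`inner_errorOp_cosetState`). If `a ∉ C₁` it leaves `Q`; if `b ∉ C₂^⊥` the character sums over
cosets vanish. In both cases `P E P = 0`. If `(a|b) ∈ C` it fixes `Q` pointwise. So only labels in
`C^⊥* \ C` can go undetected, and for each of these two coset states already witness the failure
(`exists_not_detects`).

Detection passes to the span of any subset of these coset states, and one undetected error of least
weight fixes the distance. Hence any `2k` cosets including its two witnesses span the required
subspace; they exist because `2k ≤ p ^ k`. -/

theorem natCast_prime_eq_zero (hπ : Zsqrtd.norm π = p) : (p : Gres π) = 0 := by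
  have h : ((p : ℤ) : GaussianInt) = π * star π := by rw [← hπ, Zsqrtd.norm_eq_mul_conj]
  have h' : Ideal.Quotient.mk (Ideal.span {π}) ((p : ℤ) : GaussianInt) = 0 := by
    rw [h, Ideal.Quotient.eq_zero_iff_mem]
    exact Ideal.mul_mem_right _ _ (Ideal.mem_span_singleton_self π)
  simpa using h'

theorem nontrivial_gres (hp : p.Prime) (hπ : Zsqrtd.norm π = p) : Nontrivial (Gres π) := by
  refine Ideal.Quotient.nontrivial_iff.2 fun h => ?_
  rw [Ideal.span_singleton_eq_top] at h
  have := Zsqrtd.norm_eq_one_iff.2 h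
  rw [hπ, Int.natAbs_natCast] at this
  exact hp.one_lt.ne' this

theorem charP_gres (hp : p.Prime) (hπ : Zsqrtd.norm π = p) : CharP (Gres π) p :=
  have := nontrivial_gres hp hπ
  (CharP.ringChar_of_prime_eq_zero hp (natCast_prime_eq_zero hπ)) ▸ ringChar.charP (Gres π)

theorem bijective_castHom (hp : p.Prime) (hπ : Zsqrtd.norm π = p) :
    haveI := charP_gres hp hπ
    Function.Bijective (ZMod.castHom (dvd_refl p) (Gres π)) := by
  have := charP_gres hp hπ
  have := Fact.mk hp
  have := nontrivial_gres hp hπ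
  refine ⟨RingHom.injective _, fun x => ⟨(muInv x : ZMod p), ?_⟩⟩
  rw [map_natCast, natCast_muInv hp hπ]

theorem isField_gres (hp : p.Prime) (hπ : Zsqrtd.norm π = p) : IsField (Gres π) := by
  have := charP_gres hp hπ
  have := Fact.mk hp
  exact (RingEquiv.ofBijective _ (bijective_castHom hp hπ)).symm.toMulEquiv.isField
    (Field.toIsField (ZMod p))

theorem isMaximal_span (hp : p.Prime) (hπ : Zsqrtd.norm π = p) : (Ideal.span {π}).IsMaximal :=
  Ideal.Quotient.maximal_of_isField _ (isField_gres hp hπ)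

theorem natCard_gres (hp : p.Prime) (hπ : Zsqrtd.norm π = p) : Nat.card (Gres π) = p := by
  have := charP_gres hp hπ
  rw [← Nat.card_congr (Equiv.ofBijective _ (bijective_castHom hp hπ)), Nat.card_zmod]

theorem muInv_add_modEq (hp : p.Prime) (hπ : Zsqrtd.norm π = p) (x y : Gres π) :
    muInv (x + y) ≡ muInv x + muInv y [MOD p] := by
  have := charP_gres hp hπ
  rw [← CharP.natCast_eq_natCast (Gres π) p]
  push_cast
  simp only [natCast_muInv hp hπ]

theorem muInv_zero : muInv (0 : Gres π) = 0 :=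
  Nat.sInf_eq_zero.2 (Or.inl (by simp))

/-- The additive character `x ↦ ξ ^ μ⁻¹(x)` of `G_π`. -/
noncomputable def phaseChar (hp : p.Prime) (hπ : Zsqrtd.norm π = p) {ξ : ℂ}
    (hξ : IsPrimitiveRoot ξ p) : AddChar (Gres π) ℂ where
  toFun x := ξ ^ muInv x
  map_zero_eq_one' := by rw [muInv_zero, pow_zero]
  map_add_eq_mul' x y := by
    rw [← pow_add, pow_eq_pow_mod _ hξ.pow_eq_one, muInv_add_modEq hp hπ x y,
      ← pow_eq_pow_mod _ hξ.pow_eq_one]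

theorem phaseChar_eq_one (hp : p.Prime) (hπ : Zsqrtd.norm π = p) {ξ : ℂ}
    (hξ : IsPrimitiveRoot ξ p) {x : Gres π} (h : phaseChar hp hπ hξ x = 1) : x = 0 := by
  have := charP_gres hp hπ
  rw [← natCast_muInv hp hπ x]
  exact (CharP.cast_eq_zero_iff _ p _).2 (hξ.dvd_of_pow_eq_one _ h)

theorem prod_pow_muInv (hp : p.Prime) (hπ : Zsqrtd.norm π = p) {ξ : ℂ}
    (hξ : IsPrimitiveRoot ξ p) {n : ℕ} (b u : Fin n → Gres π) :
    ∏ i, ξ ^ muInv (b i * u i) = phaseChar hp hπ hξ (b ⬝ᵥ u) := by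
  exact (map_prod (phaseChar hp hπ hξ).toMonoidHom
    (fun i => Multiplicative.ofAdd (b i * u i)) Finset.univ).symm

end Residue

/-! ### Dimension counts over a field. -/

section Dual

variable {K : Type*} [Field K] {n : ℕ} {W D : Submodule K (Fin n → K)}

/-- The dot product identifies `D` with the annihilator of `W`. Over an abstract field `D` is given
by its membership condition; `G_π` receives its field structure only where this is applied. -/
theorem finrank_dual_add (hD : ∀ v, v ∈ D ↔ ∀ u ∈ W, v ⬝ᵥ u = 0) :
    Module.finrank K D + Module.finrank K W = n := by
  have h : D.map (dotProductEquiv K (Fin n)).toLinearMap = W.dualAnnihilator := by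
    ext f
    obtain ⟨v, rfl⟩ := (dotProductEquiv K (Fin n)).surjective f
    rw [Submodule.mem_dualAnnihilator]
    simp [hD]
  have h' := Subspace.finrank_add_finrank_dualAnnihilator_eq W
  rw [← h, LinearEquiv.finrank_map_eq, Module.finrank_fin_fun] at h'
  omega

theorem dual_dual_eq (hD : ∀ v, v ∈ D ↔ ∀ u ∈ W, v ⬝ᵥ u = 0) {D' : Submodule K (Fin n → K)}
    (hD' : ∀ v, v ∈ D' ↔ ∀ u ∈ D, v ⬝ᵥ u = 0) : D' = W := by
  have h1 := finrank_dual_add hD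
  have h2 := finrank_dual_add hD'
  refine (Submodule.eq_of_le_of_finrank_eq (fun u hu => (hD' u).2 fun v hv => ?_) (by omega)).symm
  rw [dotProduct_comm]
  exact (hD v).1 hv u hu

theorem finrank_prod_submodule {V V' : Type*} [AddCommGroup V] [Module K V] [AddCommGroup V']
    [Module K V'] [FiniteDimensional K V] [FiniteDimensional K V'] (A : Submodule K V)
    (B : Submodule K V') :
    Module.finrank K (A.prod B) = Module.finrank K A + Module.finrank K B := by
  have h : (A.subtype.prodMap B.subtype).range = A.prod B := by
    rw [LinearMap.range_prodMap, Submodule.range_subtype, Submodule.range_subtype]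
  rw [← h, LinearMap.finrank_range_of_inj, Module.finrank_prod]
  exact A.subtype_injective.prodMap B.subtype_injective

theorem finrank_map_mkQ_add {V : Type*} [AddCommGroup V] [Module K V] [FiniteDimensional K V]
    {A B : Submodule K V} (h : B ≤ A) :
    Module.finrank K (A.map B.mkQ) + Module.finrank K B = Module.finrank K A := by
  rw [← LinearMap.finrank_range_add_finrank_ker (B.mkQ ∘ₗ A.subtype), LinearMap.range_comp,
    Submodule.range_subtype, LinearMap.ker_comp, Submodule.ker_mkQ,
    (Submodule.comapSubtypeEquivOfLe h).finrank_eq]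

end Dual

/-! ### Coset states and the errors they detect. -/

section CosetStates

variable {π : GaussianInt} [NeZero π] {n : ℕ} {C₁ C₂ : Submodule (Gres π) (Fin n → Gres π)}

open Classical in
/-- The sum of the basis states `|u⟩` over the elements `u` of a coset of `C₂`. -/
noncomputable def cosetState (q : (Fin n → Gres π) ⧸ C₂) : HSpace π n :=
  WithLp.toLp 2 fun u => if C₂.mkQ u = q then 1 else 0

open Classical in
theorem inner_cosetState (q q' : (Fin n → Gres π) ⧸ C₂) :
    inner ℂ (cosetState q') (cosetState q) =
      if q' = q then ∑ u, if C₂.mkQ u = q then (1 : ℂ) else 0 else 0 := by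
  simp only [cosetState, PiLp.inner_apply, RCLike.inner_apply]
  split_ifs with h
  · subst h
    refine Finset.sum_congr rfl fun u _ => ?_
    split_ifs <;> simp
  · refine Finset.sum_eq_zero fun u _ => ?_
    split_ifs with h1 h2
    · exact absurd (h2.symm.trans h1) h
    all_goals simp

theorem inner_cosetState_self_ne_zero (q : (Fin n → Gres π) ⧸ C₂) :
    inner ℂ (cosetState q) (cosetState q) ≠ 0 := by
  obtain ⟨u, hu⟩ := C₂.mkQ_surjective q
  refine inner_self_ne_zero.2 fun h => ?_
  have := congrArg (fun ψ : HSpace π n => ψ u) h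
  simp [cosetState, ← hu] at this

theorem inner_cosetState_of_ne {q q' : (Fin n → Gres π) ⧸ C₂} (h : q' ≠ q) :
    inner ℂ (cosetState q') (cosetState q) = 0 := by
  rw [inner_cosetState, if_neg h]

theorem linearIndependent_cosetState :
    LinearIndependent ℂ (cosetState : (Fin n → Gres π) ⧸ C₂ → HSpace π n) :=
  linearIndependent_of_ne_zero_of_inner_eq_zero
    (fun q => inner_self_ne_zero.1 (inner_cosetState_self_ne_zero q))
    (fun _ _ h => inner_cosetState_of_ne h)

/-- The quantum code spanned by the coset states in `T`. -/
noncomputable def cosetCode (T : Set ((Fin n → Gres π) ⧸ C₂)) : Submodule ℂ (HSpace π n) :=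
  Submodule.span ℂ (cosetState '' T)

theorem cosetCode_mono {S T : Set ((Fin n → Gres π) ⧸ C₂)} (h : S ⊆ T) :
    cosetCode S ≤ cosetCode T :=
  Submodule.span_mono (Set.image_mono h)

theorem cosetState_mem {T : Set ((Fin n → Gres π) ⧸ C₂)} {q : (Fin n → Gres π) ⧸ C₂}
    (h : q ∈ T) : cosetState q ∈ cosetCode T :=
  Submodule.subset_span (Set.mem_image_of_mem _ h)

theorem finrank_cosetCode (T : Set ((Fin n → Gres π) ⧸ C₂)) :
    Module.finrank ℂ (cosetCode T) = T.ncard := by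
  classical
  have : Fintype T := Fintype.ofFinite T
  have h : LinearIndependent ℂ (fun q : T => (cosetState q.1 : HSpace π n)) :=
    linearIndependent_cosetState.comp _ Subtype.val_injective
  rw [cosetCode, Set.image_eq_range, finrank_span_eq_card h, Set.ncard_eq_toFinset_card',
    Set.toFinset_card]

/-- Both sides are sesquilinear, so the spanning states suffice, provided one `c` serves all pairs.
-/
theorem detects_cosetCode {T : Set ((Fin n → Gres π) ⧸ C₂)} {E : HSpace π n →ₗ[ℂ] HSpace π n}
    (c : ℂ) (h : ∀ q' ∈ T, ∀ q ∈ T, inner ℂ (cosetState q') (E (cosetState q)) =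
      c * inner ℂ (cosetState q') (cosetState q)) : Detects (cosetCode T) E := by
  refine ⟨c, fun x hx y hy => ?_⟩
  induction hx using Submodule.span_induction with
  | zero => simp
  | add x x' _ _ h1 h2 => rw [inner_add_left, inner_add_left, h1, h2, mul_add]
  | smul a x _ h1 => rw [inner_smul_left, inner_smul_left, h1]; ring
  | mem x hx =>
    obtain ⟨q', hq', rfl⟩ := hx
    induction hy using Submodule.span_induction with
    | zero => simp
    | add y y' _ _ h1 h2 => rw [map_add, inner_add_right, inner_add_right, h1, h2, mul_add]
    | smul a y _ h1 => rw [map_smul, inner_smul_right, inner_smul_right, h1]; ring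
    | mem y hy =>
      obtain ⟨q, hq, rfl⟩ := hy
      exact h q' hq' q hq

variable {p : ℕ} (hp : p.Prime) (hπ : Zsqrtd.norm π = p) {ξ : ℂ} (hξ : IsPrimitiveRoot ξ p)

open Classical in
theorem inner_errorOp_cosetState (w : Pairs π n) (q q' : (Fin n → Gres π) ⧸ C₂) :
    inner ℂ (cosetState q') (errorOp ξ w (cosetState q)) =
      if q' = q + C₂.mkQ w.1 then
        ∑ u, if C₂.mkQ u = q then phaseChar hp hπ hξ (w.2 ⬝ᵥ u) else 0 else 0 := by
  have h1 : inner ℂ (cosetState q') (errorOp ξ w (cosetState q)) =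
      ∑ u, if C₂.mkQ u = q' ∧ C₂.mkQ (u - w.1) = q
        then phaseChar hp hπ hξ (w.2 ⬝ᵥ (u - w.1)) else 0 := by
    simp only [cosetState, PiLp.inner_apply, RCLike.inner_apply, errorOp, shiftOp, phaseOp,
      LinearMap.comp_apply, LinearMap.coe_mk, AddHom.coe_mk, prod_pow_muInv hp hπ hξ]
    refine Finset.sum_congr rfl fun u _ => ?_
    by_cases h : C₂.mkQ u = q' <;> by_cases h' : C₂.mkQ (u - w.1) = q <;> simp only [h, h'] <;> simp
  -- Substituting `u + a` for `u` moves the shift from the character to the coset condition.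
  rw [h1, ← Equiv.sum_comp (Equiv.addRight w.1)]
  simp only [Equiv.coe_addRight, add_sub_cancel_right, map_add]
  split_ifs with h
  · refine Finset.sum_congr rfl fun u _ => if_congr ?_ rfl rfl
    rw [h, add_left_inj, and_self]
  · refine Finset.sum_eq_zero fun u _ => if_neg fun h' => h ?_
    rw [← h'.1, ← h'.2]

open Classical in
-- Translation by some `c ∈ C₂` with `b · c ≠ 0` preserves the coset but multiplies the sum by a
-- character value other than 1.
theorem sum_phaseChar_eq_zero {b : Fin n → Gres π} (hb : b ∉ dualCode C₂)
    (q : (Fin n → Gres π) ⧸ C₂) :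
    (∑ u, if C₂.mkQ u = q then phaseChar hp hπ hξ (b ⬝ᵥ u) else 0) = 0 := by
  obtain ⟨c, hc, hbc⟩ : ∃ c ∈ C₂, b ⬝ᵥ c ≠ 0 := by
    by_contra! h
    exact hb h
  have h0 : C₂.mkQ c = 0 := (Submodule.Quotient.mk_eq_zero C₂).2 hc
  refine eq_zero_of_mul_eq_self_left (fun h => hbc (phaseChar_eq_one hp hπ hξ h)) ?_
  conv_rhs => rw [← Equiv.sum_comp (Equiv.addLeft c)]
  rw [Finset.mul_sum]
  refine Finset.sum_congr rfl fun u _ => ?_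
  simp only [Equiv.coe_addLeft, map_add, h0, zero_add, dotProduct_add, AddChar.map_add_eq_mul,
    mul_ite, mul_zero]

open Classical in
-- The character is constant on each coset of `C₂`.
theorem sum_phaseChar_eq_mul {b : Fin n → Gres π} (hb : b ∈ dualCode C₂) (x : Fin n → Gres π) :
    (∑ u, if C₂.mkQ u = C₂.mkQ x then phaseChar hp hπ hξ (b ⬝ᵥ u) else 0) =
      phaseChar hp hπ hξ (b ⬝ᵥ x) * inner ℂ (cosetState (C₂.mkQ x)) (cosetState (C₂.mkQ x)) := by
  rw [inner_cosetState, if_pos rfl, Finset.mul_sum]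
  refine Finset.sum_congr rfl fun u _ => ?_
  split_ifs with h
  · have h' : b ⬝ᵥ (u - x) = 0 := hb _ ((Submodule.Quotient.eq C₂).1 h)
    rw [dotProduct_sub, sub_eq_zero] at h'
    rw [h', mul_one]
  · rw [mul_zero]

include hp hπ hξ

theorem detects_of_not_mem {w : Pairs π n} (hw : w ∉ C₁.prod (dualCode C₂))
    {T : Set ((Fin n → Gres π) ⧸ C₂)} (hT : T ⊆ C₁.map C₂.mkQ) (h21 : C₂ ≤ C₁) :
    Detects (cosetCode T) (errorOp ξ w) := by
  refine detects_cosetCode 0 fun q' hq' q hq => ?_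
  rw [inner_errorOp_cosetState hp hπ hξ, zero_mul]
  split_ifs with h
  · refine sum_phaseChar_eq_zero hp hπ hξ (fun hb => hw ⟨?_, hb⟩) q
    have h' : C₂.mkQ w.1 ∈ C₁.map C₂.mkQ := by
      rw [← add_sub_cancel_left q (C₂.mkQ w.1), ← h]
      exact Submodule.sub_mem _ (hT hq') (hT hq)
    rwa [← Submodule.mem_comap, Submodule.comap_map_mkQ, sup_eq_right.2 h21] at h'
  · rfl

theorem detects_of_mem {w : Pairs π n} (hw : w ∈ C₂.prod (dualCode C₁))
    {T : Set ((Fin n → Gres π) ⧸ C₂)} (hT : T ⊆ C₁.map C₂.mkQ) (h21 : C₂ ≤ C₁) :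
    Detects (cosetCode T) (errorOp ξ w) := by
  refine detects_cosetCode 1 fun q' hq' q hq => ?_
  obtain ⟨x, hx, rfl⟩ := hT hq
  have h0 : C₂.mkQ w.1 = 0 := (Submodule.Quotient.mk_eq_zero C₂).2 hw.1
  rw [inner_errorOp_cosetState hp hπ hξ, h0, add_zero, one_mul]
  split_ifs with h
  · rw [h, sum_phaseChar_eq_mul hp hπ hξ (fun u hu => hw.2 u (h21 hu)), hw.2 x hx,
      AddChar.map_zero_eq_one, one_mul]
  · rw [inner_cosetState_of_ne h]

/-- If `a ∈ C₂`, the error is diagonal on coset states with two different eigenvalues; otherwise it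
has a nonzero off-diagonal entry. The two cosets are chosen before `T`, so they serve the full code
and the subcode alike. -/
theorem exists_not_detects {w : Pairs π n} (hw : w ∈ C₁.prod (dualCode C₂))
    (hw' : w ∉ C₂.prod (dualCode C₁)) :
    ∃ q ∈ C₁.map C₂.mkQ, ∃ q' ∈ C₁.map C₂.mkQ, q ≠ q' ∧
      ∀ T : Set ((Fin n → Gres π) ⧸ C₂), q ∈ T → q' ∈ T →
        ¬ Detects (cosetCode T) (errorOp ξ w) := by
  have hdiag (x : Fin n → Gres π) :=
    (sum_phaseChar_eq_mul hp hπ hξ hw.2 x).symm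
  have hself := inner_cosetState_self_ne_zero (C₂ := C₂)
  by_cases ha : w.1 ∈ C₂
  · obtain ⟨x, hx, hbx⟩ : ∃ x ∈ C₁, w.2 ⬝ᵥ x ≠ 0 := by
      by_contra! h
      exact hw' ⟨ha, h⟩
    have h0 : C₂.mkQ w.1 = 0 := (Submodule.Quotient.mk_eq_zero C₂).2 ha
    refine ⟨C₂.mkQ 0, Submodule.mem_map_of_mem (zero_mem _), C₂.mkQ x,
      Submodule.mem_map_of_mem hx, fun h => hbx ?_, fun T h1 h2 ⟨c, hc⟩ => hbx ?_⟩
    · rw [map_zero] at h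
      exact hw.2 x ((Submodule.Quotient.mk_eq_zero C₂).1 h.symm)
    · have key (y : Fin n → Gres π) (hy : C₂.mkQ y ∈ T) : phaseChar hp hπ hξ (w.2 ⬝ᵥ y) = c := by
        have := hc _ (cosetState_mem hy) _ (cosetState_mem hy)
        rw [inner_errorOp_cosetState hp hπ hξ, h0, add_zero, if_pos rfl, ← hdiag] at this
        exact mul_right_cancel₀ (hself _) this
      refine phaseChar_eq_one hp hπ hξ ((key x h2).trans (key 0 h1).symm |>.trans ?_)
      rw [dotProduct_zero, AddChar.map_zero_eq_one]
  · have hne : C₂.mkQ w.1 ≠ C₂.mkQ 0 := by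
      rw [map_zero]
      exact fun h => ha ((Submodule.Quotient.mk_eq_zero C₂).1 h)
    refine ⟨C₂.mkQ 0, Submodule.mem_map_of_mem (zero_mem _), C₂.mkQ w.1,
      Submodule.mem_map_of_mem hw.1, hne.symm, fun T h1 h2 ⟨c, hc⟩ => ?_⟩
    have := hc _ (cosetState_mem h2) _ (cosetState_mem h1)
    rw [inner_errorOp_cosetState hp hπ hξ, inner_cosetState_of_ne hne, map_zero, zero_add,
      if_pos rfl, ← map_zero C₂.mkQ, ← hdiag, dotProduct_zero, AddChar.map_zero_eq_one, one_mul,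
      mul_zero] at this
    exact hself _ this

end CosetStates

/-- Not every label in `S` need be undetected: a single one of least weight is enough, which is what
small subcodes can provide. -/
theorem hasMinDist_of_isLeast {π : GaussianInt} [NeZero π] {n : ℕ} {ξ : ℂ}
    {Q : Submodule ℂ (HSpace π n)} {S : Set (Pairs π n)} {d : ℕ}
    (hdet : ∀ w ∉ S, Detects Q (errorOp ξ w)) (hd : IsLeast (wtM '' S) d)
    (hw : ∃ w, wtM w = d ∧ ¬ Detects Q (errorOp ξ w)) : HasMinDist ξ Q d := by
  obtain ⟨w, hwd, hw⟩ := hw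
  refine ⟨⟨w, hw, hwd⟩, ?_⟩
  rintro m ⟨w', hw', rfl⟩
  exact hd.2 ⟨w', by_contra fun h => hw' (hdet w' h), rfl⟩

/-! ### Duals and dimensions of product codes over `G_π`. -/

section SymplecticDual

variable {π : GaussianInt} {n : ℕ} {C₁ C₂ : Submodule (Gres π) (Fin n → Gres π)}

theorem symplDual_prod (A B : Submodule (Gres π) (Fin n → Gres π)) :
    symplDual (A.prod B) = (dualCode B).prod (dualCode A) := by
  ext w
  constructor
  · intro h
    refine ⟨fun v hv => ?_, fun u hu => ?_⟩
    · have := h (0, v) ⟨zero_mem _, hv⟩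
      simpa [sympl, dotProduct_comm v] using this
    · have := h (u, 0) ⟨hu, zero_mem _⟩
      simpa [sympl] using this
  · rintro ⟨h1, h2⟩ w' ⟨h1', h2'⟩
    rw [sympl, h2 _ h1', dotProduct_comm, h1 _ h2', sub_zero]

variable {p : ℕ} (hp : p.Prime) (hπ : Zsqrtd.norm π = p)

include hp hπ

theorem dualCode_dualCode (A : Submodule (Gres π) (Fin n → Gres π)) :
    dualCode (dualCode A) = A := by
  have := isMaximal_span hp hπ
  let _ : Field (Gres π) := Ideal.Quotient.field (Ideal.span {π})
  exact dual_dual_eq (W := A) (D := dualCode A) (fun _ => Iff.rfl) (fun _ => Iff.rfl)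

theorem finrank_dualCode_add (A : Submodule (Gres π) (Fin n → Gres π)) :
    Module.finrank (Gres π) (dualCode A) + Module.finrank (Gres π) A = n := by
  have := isMaximal_span hp hπ
  let _ : Field (Gres π) := Ideal.Quotient.field (Ideal.span {π})
  exact finrank_dual_add (fun _ => Iff.rfl)

theorem finrank_prod_code (A B : Submodule (Gres π) (Fin n → Gres π)) :
    Module.finrank (Gres π) (A.prod B) =
      Module.finrank (Gres π) A + Module.finrank (Gres π) B := by
  have := isMaximal_span hp hπ
  let _ : Field (Gres π) := Ideal.Quotient.field (Ideal.span {π})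
  exact finrank_prod_submodule A B

theorem finrank_map_mkQ_code_add (h : C₂ ≤ C₁) :
    Module.finrank (Gres π) (C₁.map C₂.mkQ) + Module.finrank (Gres π) C₂ =
      Module.finrank (Gres π) C₁ := by
  have := isMaximal_span hp hπ
  let _ : Field (Gres π) := Ideal.Quotient.field (Ideal.span {π})
  exact finrank_map_mkQ_add h

theorem ncard_map_mkQ [NeZero π] (A : Submodule (Gres π) ((Fin n → Gres π) ⧸ C₂)) :
    (A : Set ((Fin n → Gres π) ⧸ C₂)).ncard = p ^ Module.finrank (Gres π) A := by
  have := isMaximal_span hp hπ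
  let _ : Field (Gres π) := Ideal.Quotient.field (Ideal.span {π})
  rw [← natCard_gres hp hπ]
  exact Module.natCard_eq_pow_finrank (K := Gres π) (V := A)

end SymplecticDual

theorem two_mul_le_pow {p : ℕ} (hp : 2 ≤ p) (k : ℕ) : 2 * k ≤ p ^ k := by
  refine le_trans ?_ (Nat.pow_le_pow_left hp k)
  cases k with
  | zero => simp
  | succ k =>
    have := Nat.lt_two_pow_self (n := k)
    omega

end MannheimQuantum

open MannheimQuantum in
theorem theorem2 (p : ℕ) (hp : p.Prime) (hp4 : p % 4 = 1)
    (π : GaussianInt) [NeZero π] (hπ : Zsqrtd.norm π = (p : ℤ))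
    (ξ : ℂ) (hξ : IsPrimitiveRoot ξ p)
    (n : ℕ) (C₁ C₂ : Submodule (Gres π) (Fin n → Gres π))
    (C : Submodule (Gres π) (Pairs π n)) (hC : C = C₂.prod (dualCode C₁))
    (hself : C ≤ symplDual C) :
    ∃ k : ℕ,
      Module.finrank (Gres π) (symplDual C) = Module.finrank (Gres π) C + 2 * k ∧
      ∃ Q : Submodule ℂ (HSpace π n),
        Module.finrank ℂ Q = p ^ k ∧
        (∀ d : ℕ, IsLeast (wtM '' ((symplDual C : Set (Pairs π n)) \ C)) d →
          HasMinDist ξ Q d) ∧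
        ∃ Q' : Submodule ℂ (HSpace π n), Q' ≤ Q ∧
          Module.finrank ℂ Q' = 2 * k ∧
          (∀ d : ℕ, IsLeast (wtM '' ((symplDual C : Set (Pairs π n)) \ C)) d →
            HasMinDist ξ Q' d) := by
  subst hC
  have hdual : symplDual (C₂.prod (dualCode C₁)) = C₁.prod (dualCode C₂) := by
    rw [symplDual_prod, dualCode_dualCode hp hπ]
  rw [hdual] at hself ⊢
  have h21 : C₂ ≤ C₁ := fun u hu => (@hself (u, 0) ⟨hu, zero_mem (dualCode C₁)⟩).1
  have hquot := finrank_map_mkQ_code_add hp hπ h21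
  set k := Module.finrank (Gres π) (C₁.map C₂.mkQ)
  set T : Set ((Fin n → Gres π) ⧸ C₂) := ↑(C₁.map C₂.mkQ)
  have hcard : T.ncard = p ^ k := ncard_map_mkQ hp hπ _
  have hdet : ∀ S ⊆ T, ∀ w ∉ (C₁.prod (dualCode C₂) : Set (Pairs π n)) \ C₂.prod (dualCode C₁),
      Detects (cosetCode S) (errorOp ξ w) := by
    intro S hS w hw
    by_cases h : w ∈ C₁.prod (dualCode C₂)
    · exact detects_of_mem hp hπ hξ (by_contra fun h' => hw ⟨h, h'⟩) hS h21
    · exact detects_of_not_mem hp hπ hξ h hS h21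
  obtain ⟨T', hT'T, hT', hdist⟩ : ∃ T' ⊆ T, T'.ncard = 2 * k ∧ ∀ d : ℕ,
      IsLeast (wtM '' ((C₁.prod (dualCode C₂) : Set (Pairs π n)) \ C₂.prod (dualCode C₁))) d →
      ∀ S, T' ⊆ S → S ⊆ T → HasMinDist ξ (cosetCode S) d := by
    have hle : 2 * k ≤ T.ncard := hcard ▸ two_mul_le_pow hp.two_le k
    by_cases hd : ∃ d : ℕ, IsLeast
      (wtM '' ((C₁.prod (dualCode C₂) : Set (Pairs π n)) \ C₂.prod (dualCode C₁))) d
    · obtain ⟨d, hd⟩ := hd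
      obtain ⟨w, ⟨hw, hw'⟩, hwd⟩ := hd.1
      obtain ⟨q, hq, q', hq', hne, hnot⟩ := exists_not_detects hp hπ hξ hw hw'
      have hsub : {q, q'} ⊆ T := Set.insert_subset hq (Set.singleton_subset_iff.2 hq')
      have hpair : ({q, q'} : Set ((Fin n → Gres π) ⧸ C₂)).ncard = 2 := Set.ncard_pair hne
      -- Two distinct cosets rule out `k = 0`, so `2k` leaves room for the pair.
      have hk : 1 ≤ k := by
        by_contra! hk
        have := Set.ncard_le_ncard hsub
        rw [hpair, hcard, Nat.lt_one_iff.1 hk, pow_zero] at this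
        omega
      obtain ⟨T', hqT', hT'T, hT'⟩ := Set.exists_subsuperset_card_eq hsub (by omega) hle
      refine ⟨T', hT'T, hT', fun d' hd' S hS hST => ?_⟩
      exact hasMinDist_of_isLeast (hdet S hST) hd' ⟨w, hwd.trans (hd.unique hd'),
        hnot S (hS (hqT' (by simp))) (hS (hqT' (by simp)))⟩
    -- Without a least weight the distance claim is vacuous and any `2k` cosets do.
    · obtain ⟨T', -, hT'T, hT'⟩ := Set.exists_subsuperset_card_eq (Set.empty_subset T) (by simp) hle
      exact ⟨T', hT'T, hT', fun d h => absurd ⟨d, h⟩ hd⟩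
  refine ⟨k, ?_, cosetCode T, by rw [finrank_cosetCode, hcard], fun d hd => hdist d hd T hT'T le_rfl,
    cosetCode T', cosetCode_mono hT'T, by rw [finrank_cosetCode, hT'],
    fun d hd => hdist d hd T' le_rfl hT'T⟩
  have h1 := finrank_dualCode_add hp hπ C₁
  have h2 := finrank_dualCode_add hp hπ C₂
  rw [finrank_prod_code hp hπ, finrank_prod_code hp hπ]
  omega
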